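/- Let $D\subset\mathbb{R}^p$ (space) and $R\subset\mathbb{R}^q$ (rays, i.e. direction coordinates and frequency) be such that $\mathcal{D}=D\times R\subset\mathbb{R}^{p+q}$ is Peano–Jordan measurable (bounded, with boundary of measure zero). Let * $\gamma:D\times R\to\mathbb{R}$ be Riemann integrable in the generalized sense, possibly unbounded: for every $\varepsilon>0$ there is a compact Peano–Jordan measurable set $A\subset\mathcal{D}$ with $|\mathcal{D}\setminus A|\le\varepsilon$ on which $\gamma$ is bounded and Riemann integrable (convergence of the improper integral is not required); * $\Phi:D\times R\times R\to\mathbb{R}$ be a kernel such that $\Phi(\mathbf{x},\cdot,\cdot)$ is Riemann integrable on $R\times R$ for every $\mathbf{x}\in D$, with a bound that is locally uniform in $\mathbf{x}$: for every compact $A\subset D$, $\Phi$ is bounded on $A\times R\times R$. For $n=0,1,2,\dots$ let $\mathbf{x}_1,\dots,\mathbf{x}_{N_s}\in D$ be spatial nodes, $\mathbf{r}_1,\dots,\mathbf{r}_{N_r}\in R$ distinct rays and $w_1,\dots,w_{N_r}\in\mathbb{R}$ weights (all depending on $n$), with $N_r\to\infty$ as $n\to\infty$, and put $N=N_sN_r$.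 Assume that * the grid points $(\mathbf{x}_i,\mathbf{r}_k)$ are asymptotically distributed according to some probability measure $\nu$ on $\mathbb{R}^{p+q}$ that is absolutely continuous with respect to Lebesgue measure (for uniform grids, the normalized Lebesgue measure of $\mathcal{D}$): $\frac1N\sum_{i,k}g(\mathbf{x}_i,\mathbf{r}_k)\to\int g\,\mathrm{d}\nu$ for every bounded continuous $g$; * the quadrature rule converges: $\frac1{N_r}\sum_{k}w_k\,g(\mathbf{r}_k)\to\int_R g(\mathbf{r})\,\mathrm{d}\mathbf{r}$ for every continuous $g:\mathbb{R}^q\to\mathbb{R}$. Let $\Sigma_N=\Gamma_N\Psi_NW_N\in\mathbb{R}^{N\times N}$, where all three factors are block diagonal with $N_s$ blocks of size $N_r$: the $i$-th blocks are $$\Gamma_{[i]}=\operatorname{diag}_k\gamma(\mathbf{x}_i,\mathbf{r}_k),\qquad \Psi_{[i]}=\bigl[\Phi(\mathbf{x}_i,\mathbf{r}_k,\mathbf{r}_l)\bigr]_{k,l=1}^{N_r},\qquad W_r=\tfrac1{N_r}\operatorname{diag}_k w_k ,$$ the last one for every $i$. Then $\{\Sigma_N\}$ is weakly clustered at zero in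 the singular value sense, i.e. for every $\varepsilon>0$ $$\#\{j:\sigma_j(\Sigma_N)\ge\varepsilon\}=o(N)\qquad(n\to\infty),$$ and $\{\Sigma_N\}\sim_\sigma(0,K)$ for every measurable $K$ in a Euclidean space with positive and finite Lebesgue measure $|K|$: for every $F:[0,\infty)\to\mathbb{C}$ continuous with bounded support, $$\lim_{n\to\infty}\frac1N\sum_{j=1}^{N}F(\sigma_j(\Sigma_N))=\frac1{|K|}\int_K F(0)\,\mathrm{d}z=F(0).$$ -/

import Mathlib

open MeasureTheory Filter Topology Asymptotics

noncomputable section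

/-! ### Jordan content and Riemann integrability in `ℝ^ι` -/

/-- Peano–Jordan measurable sets: bounded, with a boundary of Lebesgue measure zero. -/
def IsPeanoJordan {ι : Type} [Fintype ι] (E : Set (ι → ℝ)) : Prop :=
  Bornology.IsBounded E ∧ volume (frontier E) = 0

/-- `f` is (properly) Riemann integrable on the bounded set `E`: it is bounded on `E`, and its
extension by zero is Riemann integrable over a box that contains `E`. -/
def RiemannIntegrableOn {ι : Type} [Fintype ι] (f : (ι → ℝ) → ℝ) (E : Set (ι → ℝ)) : Prop :=
  (∃ C : ℝ, ∀ z ∈ E, |f z| ≤ C) ∧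
    ∃ I : BoxIntegral.Box ι, E ⊆ (I : Set (ι → ℝ)) ∧
      BoxIntegral.Integrable I BoxIntegral.IntegrationParams.Riemann (E.indicator f)
        (volume : Measure (ι → ℝ)).toBoxAdditive.toSMul

/-- `f`, possibly unbounded, is Riemann integrable in the generalized sense on `K`: `K` is
exhausted, up to sets of arbitrarily small measure, by compact Peano–Jordan sets on which `f` is
properly Riemann integrable. Convergence of the integrals along the exhaustion is not required, so
this includes every function with a convergent improper Riemann integral. -/
def GenRiemannIntegrableOn {ι : Type} [Fintype ι] (f : (ι → ℝ) → ℝ) (K : Set (ι → ℝ)) : Prop :=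
  ∀ ε : ℝ, 0 < ε → ∃ A : Set (ι → ℝ), A ⊆ K ∧ IsCompact A ∧ IsPeanoJordan A ∧
    volume (K \ A) ≤ ENNReal.ofReal ε ∧ RiemannIntegrableOn f A

/-- The product `D × R` as a subset of `ℝ^(p+q)`. -/
def prodSet {p q : ℕ} (D : Set (Fin p → ℝ)) (R : Set (Fin q → ℝ)) : Set (Fin p ⊕ Fin q → ℝ) :=
  {z | z ∘ Sum.inl ∈ D ∧ z ∘ Sum.inr ∈ R}

/-- A function of two vector variables as a function on `ℝ^(p+q)`. -/
def onProd {p q : ℕ} (f : (Fin p → ℝ) → (Fin q → ℝ) → ℝ) (z : Fin p ⊕ Fin q → ℝ) : ℝ :=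
  f (z ∘ Sum.inl) (z ∘ Sum.inr)

/-! ### Singular values, clusters and distributions of matrix sequences -/

/-- The singular values `σ₀ ≥ σ₁ ≥ …` of a square matrix; those with index `i < card κ` are its
singular values counted with multiplicity. -/
def matrixSingularValue {κ : Type} [Fintype κ] [DecidableEq κ] (A : Matrix κ κ ℝ) (i : ℕ) : ℝ :=
  (Matrix.toEuclideanLin A).singularValues i

/-- The number of singular values of `A` (with multiplicity) that are off `{t : |t - s| < ε}`. -/
def numSingularValuesOff {κ : Type} [Fintype κ] [DecidableEq κ] (A : Matrix κ κ ℝ)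
    (s ε : ℝ) : ℕ :=
  ((Finset.range (Fintype.card κ)).filter (fun i => ε ≤ |matrixSingularValue A i - s|)).card

/-- `{A_n}` is weakly clustered at `s` in the singular value sense. -/
def WeaklyClusteredSV {κ : ℕ → Type} [∀ n, Fintype (κ n)] [∀ n, DecidableEq (κ n)]
    (A : ∀ n, Matrix (κ n) (κ n) ℝ) (s : ℝ) : Prop :=
  ∀ ε : ℝ, 0 < ε →
    (fun n => (numSingularValuesOff (A n) s ε : ℝ)) =o[atTop]
      (fun n => (Fintype.card (κ n) : ℝ))

/-- `{A_n} ∼_σ (h, K)`: for every `F` continuous with bounded support on `[0, ∞)`, the means of `F`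
over the singular values of `A_n` converge to the mean of `F(|h|)` over `K`. -/
def DistributedSV {κ : ℕ → Type} [∀ n, Fintype (κ n)] [∀ n, DecidableEq (κ n)]
    (A : ∀ n, Matrix (κ n) (κ n) ℝ) {ι : Type} [Fintype ι] (h : (ι → ℝ) → ℂ)
    (K : Set (ι → ℝ)) : Prop :=
  ∀ F : ℝ → ℂ, ContinuousOn F (Set.Ici 0) → (∃ T : ℝ, ∀ t : ℝ, T ≤ t → F t = 0) →
    Tendsto
      (fun n => (1 / (Fintype.card (κ n) : ℂ)) *
        ∑ i ∈ Finset.range (Fintype.card (κ n)), F (matrixSingularValue (A n) i))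
      atTop
      (𝓝 ((1 / ((volume K).toReal : ℂ)) * ∫ z in K, F ‖h z‖))

/-! ### Grids and quadrature -/

/-- The tensor grids `{(x_i, r_k)}` are asymptotically distributed according to `ν`: averages of
bounded continuous functions over the grid points converge to their integrals against `ν`. -/
def GridDistributed {p q : ℕ} {Ns Nr : ℕ → ℕ} (x : ∀ n, Fin (Ns n) → Fin p → ℝ)
    (r : ∀ n, Fin (Nr n) → Fin q → ℝ) (ν : Measure (Fin p ⊕ Fin q → ℝ)) : Prop :=
  ∀ g : BoundedContinuousFunction (Fin p ⊕ Fin q → ℝ) ℝ,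
    Tendsto
      (fun n => (1 / ((Ns n : ℝ) * (Nr n : ℝ))) *
        ∑ i, ∑ k, g (Sum.elim (x n i) (r n k)))
      atTop (𝓝 (∫ z, g z ∂ν))

/-- The quadrature rules with nodes `r_k` and weights `w_k / N_r` converge to the integral over `R`
for every continuous integrand. -/
def QuadratureConverges {q : ℕ} {Nr : ℕ → ℕ} (r : ∀ n, Fin (Nr n) → Fin q → ℝ)
    (w : ∀ n, Fin (Nr n) → ℝ) (R : Set (Fin q → ℝ)) : Prop :=
  ∀ g : (Fin q → ℝ) → ℝ, Continuous g →
    Tendsto (fun n => (1 / (Nr n : ℝ)) * ∑ k, w n k * g (r n k)) atTop (𝓝 (∫ s in R, g s))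

/-! ### The scattering matrix

Rows and columns are indexed by pairs (ray index, space index), as `Matrix.blockDiagonal` does; the
block index is the space index. -/

/-- `Γ_N`: block diagonal, the block of `x_i` being `diag_k γ(x_i, r_k)`. -/
def gammaMatrix {p q Ns Nr : ℕ} (γ : (Fin p → ℝ) → (Fin q → ℝ) → ℝ)
    (x : Fin Ns → Fin p → ℝ) (r : Fin Nr → Fin q → ℝ) :
    Matrix (Fin Nr × Fin Ns) (Fin Nr × Fin Ns) ℝ :=
  Matrix.blockDiagonal fun i => Matrix.diagonal fun k => γ (x i) (r k)

/-- `Ψ_N`: block diagonal, the block of `x_i` being `[Φ(x_i, r_k, r_l)]_{k,l}`. -/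
def psiMatrix {p q Ns Nr : ℕ} (Φ : (Fin p → ℝ) → (Fin q → ℝ) → (Fin q → ℝ) → ℝ)
    (x : Fin Ns → Fin p → ℝ) (r : Fin Nr → Fin q → ℝ) :
    Matrix (Fin Nr × Fin Ns) (Fin Nr × Fin Ns) ℝ :=
  Matrix.blockDiagonal fun i => Matrix.of fun k l => Φ (x i) (r k) (r l)

/-- `W_N = Id ⊗ W_r`: every block is `W_r = (1 / N_r) diag_k w_k`. -/
def weightMatrix {Nr : ℕ} (Ns : ℕ) (w : Fin Nr → ℝ) :
    Matrix (Fin Nr × Fin Ns) (Fin Nr × Fin Ns) ℝ :=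
  Matrix.blockDiagonal fun _ => (1 / (Nr : ℝ)) • Matrix.diagonal w

/-- The scattering matrix `Σ_N = Γ_N Ψ_N W_N`. -/
def scatteringMatrix {p q Ns Nr : ℕ} (γ : (Fin p → ℝ) → (Fin q → ℝ) → ℝ)
    (Φ : (Fin p → ℝ) → (Fin q → ℝ) → (Fin q → ℝ) → ℝ)
    (x : Fin Ns → Fin p → ℝ) (r : Fin Nr → Fin q → ℝ) (w : Fin Nr → ℝ) :
    Matrix (Fin Nr × Fin Ns) (Fin Nr × Fin Ns) ℝ :=
  gammaMatrix γ x r * psiMatrix Φ x r * weightMatrix Ns w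

end

/-! The number of singular values `≥ ε` is at most the squared Frobenius norm over `ε ^ 2`, and
discarding some rows and columns costs at most their number (`numSingularValuesOff_zero_le`). So it
suffices to discard a small fraction of the `N` rows and columns and be left with squared Frobenius
norm `o(N)`.

Bad rows are grid points outside a compact Peano–Jordan set `A` on which `γ` is bounded. Absolute
continuity of `ν` and null boundaries make them a small fraction
(`GridDistributed.exists_pos_forall_eventually_card_notMem_le`). Bad columns carry a large weight.
Uniform boundedness gives `∑ |w_k| = O(N_r)` (`QuadratureConverges.exists_sum_abs_le`), so Markov's
inequality makes them rare too. On the rest, a row has `N_r` relevant entries with sum of squares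
`O(1 / N_r)`, hence the total is `O(N_s) = o(N)` as `N_r → ∞`.

Clustering at zero then gives the zero symbol: `F` is bounded, and all but `o(N)` of its arguments
are near `0`. -/

/-! ### Counting singular values with submatrices -/

/-- The right singular vectors for the singular values `≥ ε` span a subspace on which `T` expands
norms by at least `ε`. -/
theorem LinearMap.exists_submodule_mul_norm_le {E F : Type*}
    [NormedAddCommGroup E] [InnerProductSpace ℝ E] [FiniteDimensional ℝ E]
    [NormedAddCommGroup F] [InnerProductSpace ℝ F] [FiniteDimensional ℝ F]
    (T : E →ₗ[ℝ] F) {n : ℕ} (hn : Module.finrank ℝ E = n) {ε : ℝ} (hε : 0 ≤ ε) :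
    ∃ V : Submodule ℝ E,
      Module.finrank ℝ V = ((Finset.range n).filter fun i => ε ≤ T.singularValues i).card ∧
      ∀ v ∈ V, ε ^ 2 * ‖v‖ ^ 2 ≤ ‖T v‖ ^ 2 := by
  classical
  set b := T.isSymmetric_adjoint_comp_self.eigenvectorBasis hn with hb
  let I := {i : Fin n // ε ≤ T.singularValues i}
  have hli : LinearIndependent ℝ (fun i : I => b i) :=
    b.orthonormal.linearIndependent.comp _ Subtype.val_injective
  refine ⟨Submodule.span ℝ (Set.range fun i : I => b i), ?_, fun v hv => ?_⟩
  · rw [finrank_span_eq_card hli, Fintype.card_subtype]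
    refine Finset.card_bij (fun i _ => (i : ℕ)) ?_ ?_ ?_
    · intro i hi
      simpa using hi
    · intro i _ j _ h
      exact Fin.ext h
    · intro i hi
      simp only [Finset.mem_filter, Finset.mem_range] at hi
      exact ⟨⟨i, hi.1⟩, by simpa using hi.2, rfl⟩
  · have hzero : ∀ i : Fin n, ¬ ε ≤ T.singularValues i → b.repr v i = 0 := by
      intro i hi
      rw [b.repr_apply_apply]
      induction hv using Submodule.span_induction with
      | mem y hy =>
        obtain ⟨j, rfl⟩ := hy
        refine b.orthonormal.2 fun h => hi (h ▸ j.2)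
      | zero => simp
      | add y z _ _ hy hz => rw [inner_add_right, hy, hz, add_zero]
      | smul c y _ hy => rw [inner_smul_right, hy, mul_zero]
    have h1 : ‖T v‖ ^ 2 = ∑ i : Fin n, T.singularValues i ^ 2 * b.repr v i ^ 2 := by
      rw [← real_inner_self_eq_norm_sq, ← LinearMap.adjoint_inner_left, ← LinearMap.comp_apply,
        ← b.repr.inner_map_map, PiLp.inner_apply]
      refine Finset.sum_congr rfl fun i _ => ?_
      rw [hb, T.isSymmetric_adjoint_comp_self.eigenvectorBasis_apply_self_apply hn v i,
        T.sq_singularValues_fin hn i]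
      simp
      ring
    have h2 : ‖v‖ ^ 2 = ∑ i, b.repr v i ^ 2 := by
      rw [← b.repr.norm_map, EuclideanSpace.norm_sq_eq]
      simp
    rw [h1, h2, Finset.mul_sum]
    refine Finset.sum_le_sum fun i _ => ?_
    by_cases hi : ε ≤ T.singularValues i
    · gcongr
    · simp [hzero i hi]

/-- If the restriction of `A` to the rows in `S` and the columns in `T` expands norms on `U` by at
least `ε`, then `dim U` is bounded by its squared Frobenius norm over `ε ^ 2`. -/
theorem Matrix.finrank_mul_sq_le_sum_sq {κ : Type} [Fintype κ] [DecidableEq κ] (A : Matrix κ κ ℝ)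
    (S T : Finset κ) (U : Submodule ℝ (EuclideanSpace ℝ κ)) {ε : ℝ}
    (hU : ∀ u ∈ U, ε ^ 2 * ‖u‖ ^ 2 ≤ ∑ i ∈ S, (∑ j ∈ T, A i j * u j) ^ 2) :
    (Module.finrank ℝ U : ℝ) * ε ^ 2 ≤ ∑ i ∈ S, ∑ j ∈ T, A i j ^ 2 := by
  set e := stdOrthonormalBasis ℝ U
  let a : κ → EuclideanSpace ℝ κ := fun i => WithLp.toLp 2 fun j => if j ∈ T then A i j else 0
  have ho : Orthonormal ℝ fun k => (e k : EuclideanSpace ℝ κ) :=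
    e.orthonormal.comp_linearIsometry U.subtypeₗᵢ
  have ha : ∀ i (u : EuclideanSpace ℝ κ), inner ℝ u (a i) = ∑ j ∈ T, A i j * u j := by
    intro i u
    simp [a, PiLp.inner_apply, Finset.sum_ite_mem]
  have hna : ∀ i, ‖a i‖ ^ 2 = ∑ j ∈ T, A i j ^ 2 := by
    intro i
    simp [a, EuclideanSpace.norm_sq_eq, ite_pow, Finset.sum_ite_mem]
  calc (Module.finrank ℝ U : ℝ) * ε ^ 2
      = ∑ k, ε ^ 2 * ‖(e k : EuclideanSpace ℝ κ)‖ ^ 2 := by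
        simp [ho.1]
    _ ≤ ∑ k, ∑ i ∈ S, ‖inner ℝ (e k : EuclideanSpace ℝ κ) (a i)‖ ^ 2 := by
        refine Finset.sum_le_sum fun k _ => (hU _ (e k).2).trans_eq ?_
        simp [ha]
    _ = ∑ i ∈ S, ∑ k, ‖inner ℝ (e k : EuclideanSpace ℝ κ) (a i)‖ ^ 2 := Finset.sum_comm
    -- Bessel's inequality for each truncated row `a i` against an orthonormal basis of `U`.
    _ ≤ ∑ i ∈ S, ‖a i‖ ^ 2 :=
        Finset.sum_le_sum fun i _ => ho.sum_inner_products_le (a i)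
    _ = _ := Finset.sum_congr rfl fun i _ => hna i

/-- Up to the rows outside `S` and the columns outside `T`, the number of singular values `≥ ε` is
controlled by the Frobenius norm of a submatrix. -/
theorem numSingularValuesOff_zero_le {κ : Type} [Fintype κ] [DecidableEq κ] (A : Matrix κ κ ℝ)
    (S T : Finset κ) {ε : ℝ} (hε : 0 < ε) :
    (numSingularValuesOff A 0 ε : ℝ) ≤
      (Sᶜ.card : ℝ) + Tᶜ.card + (∑ i ∈ S, ∑ j ∈ T, A i j ^ 2) / ε ^ 2 := by
  obtain ⟨V, hV, hVle⟩ := (Matrix.toEuclideanLin A).exists_submodule_mul_norm_le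
    (n := Fintype.card κ) (by simp) hε.le
  have hcount : numSingularValuesOff A 0 ε = Module.finrank ℝ V := by
    rw [hV, numSingularValuesOff]
    simp only [matrixSingularValue, sub_zero, abs_of_nonneg (LinearMap.singularValues_nonneg _ _)]
  -- On the kernel of `ρ` only the `S × T` submatrix acts, and imposing `ρ v = 0` lowers the
  -- dimension of `V` by at most the number of discarded rows and columns.
  let ρ : EuclideanSpace ℝ κ →ₗ[ℝ] ({i // i ∈ Sᶜ} → ℝ) × ({j // j ∈ Tᶜ} → ℝ) :=
    { toFun := fun v => (fun i => Matrix.toEuclideanLin A v i, fun j => v j)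
      map_add' := fun v w => by ext <;> simp
      map_smul' := fun c v => by ext <;> simp }
  let f := ρ.comp V.subtype
  let U := (LinearMap.ker f).map V.subtype
  have hfin : Module.finrank ℝ V ≤ Sᶜ.card + Tᶜ.card + Module.finrank ℝ U := by
    have h1 := f.finrank_range_add_finrank_ker
    have h2 : Module.finrank ℝ (LinearMap.range f) ≤ Sᶜ.card + Tᶜ.card := by
      refine (Submodule.finrank_le _).trans_eq ?_
      rw [Module.finrank_prod, Module.finrank_fintype_fun_eq_card,
        Module.finrank_fintype_fun_eq_card, Fintype.card_coe, Fintype.card_coe]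
    have h3 : Module.finrank ℝ U = Module.finrank ℝ (LinearMap.ker f) :=
      Submodule.finrank_map_subtype_eq _ _
    omega
  have hU := A.finrank_mul_sq_le_sum_sq S T U (ε := ε) (by
    rintro _ ⟨v, hv, rfl⟩
    have hv0 : ρ v = 0 := hv
    have hrow : ∀ i ∉ S, Matrix.toEuclideanLin A (v : EuclideanSpace ℝ κ) i = 0 := fun i hi =>
      congrFun (congrArg Prod.fst hv0) ⟨i, Finset.mem_compl.2 hi⟩
    have hcol : ∀ j ∉ T, (v : EuclideanSpace ℝ κ) j = 0 := fun j hj =>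
      congrFun (congrArg Prod.snd hv0) ⟨j, Finset.mem_compl.2 hj⟩
    refine (hVle v v.2).trans_eq ?_
    rw [EuclideanSpace.norm_sq_eq]
    rw [← Finset.sum_subset (Finset.subset_univ S) fun i _ hi => by simp [hrow i hi]]
    refine Finset.sum_congr rfl fun i _ => ?_
    rw [Real.norm_eq_abs, sq_abs]
    congr 1
    rw [Matrix.toLpLin_apply]
    simp only [Matrix.mulVec, dotProduct]
    exact (Finset.sum_subset (Finset.subset_univ T) fun j _ hj => by
      rw [hcol j hj, mul_zero]).symm)
  rw [← le_div_iff₀ (by positivity)] at hU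
  have hfin' : (Module.finrank ℝ V : ℝ) ≤ Sᶜ.card + Tᶜ.card + Module.finrank ℝ U := by
    exact_mod_cast hfin
  rw [hcount]
  linarith

/-! ### Mean boundedness of quadrature weights -/

/-- The weights of a convergent quadrature rule with distinct nodes are bounded in mean. -/
theorem QuadratureConverges.exists_sum_abs_le {q : ℕ} {Nr : ℕ → ℕ}
    {r : ∀ n, Fin (Nr n) → Fin q → ℝ} {w : ∀ n, Fin (Nr n) → ℝ} {R : Set (Fin q → ℝ)}
    (hw : QuadratureConverges r w R) (hr : ∀ n, Function.Injective (r n)) :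
    ∃ C : ℝ, 0 < C ∧ ∀ n, ∑ k, |w n k| ≤ C * Nr n := by
  let L : ∀ n, BoundedContinuousFunction (Fin q → ℝ) ℝ →L[ℝ] ℝ := fun n =>
    (1 / (Nr n : ℝ)) • ∑ k, w n k • BoundedContinuousFunction.evalCLM ℝ (r n k)
  have hL : ∀ n g, L n g = (1 / (Nr n : ℝ)) * ∑ k, w n k * g (r n k) := by
    intro n g
    simp [L]
  obtain ⟨C, hC⟩ := banach_steinhaus (g := L) (fun g => by
    obtain ⟨c, hc⟩ := (hw g g.continuous).norm.bddAbove_range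
    refine ⟨c, fun n => ?_⟩
    rw [hL]
    exact hc ⟨n, rfl⟩)
  refine ⟨max C 1, by positivity, fun n => ?_⟩
  rcases Nat.eq_zero_or_pos (Nr n) with h0 | hpos
  · have : IsEmpty (Fin (Nr n)) := by rw [h0]; infer_instance
    simp [h0]
  have hpos' : (0 : ℝ) < Nr n := by exact_mod_cast hpos
  -- The signs of the weights are prescribed at the distinct nodes and extended by Tietze with norm
  -- at most 1; testing `L n` on the extension yields the mean of `|w n k|`.
  let f : BoundedContinuousFunction (Fin (Nr n)) ℝ :=
    BoundedContinuousFunction.ofNormedAddCommGroup (fun k => (SignType.sign (w n k) : ℝ))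
      continuous_of_discreteTopology 1 (fun k => by
        rcases SignType.sign (w n k) with _ | _ | _ <;> simp)
  have hf : ‖f‖ ≤ 1 := BoundedContinuousFunction.norm_ofNormedAddCommGroup_le _ zero_le_one _
  obtain ⟨g, hg, hgf⟩ := BoundedContinuousFunction.exists_extension_norm_eq_of_isClosedEmbedding f
    (Topology.IsClosedEmbedding.of_continuous_injective_isClosedMap
      (f := r n) continuous_of_discreteTopology (hr n)
      (fun s _ => (s.toFinite.image _).isClosed))
  have hval : ∀ k, g (r n k) = SignType.sign (w n k) := fun k => congrFun hgf k
  have h1 : L n g ≤ max C 1 :=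
    calc L n g ≤ ‖L n g‖ := Real.le_norm_self _
      _ ≤ ‖L n‖ * ‖g‖ := (L n).le_opNorm g
      _ ≤ max C 1 * 1 := by
        gcongr
        · exact (hC n).trans (le_max_left _ _)
        · exact hg.trans_le hf
      _ = _ := mul_one _
  rw [hL] at h1
  simp only [hval, self_mul_sign] at h1
  rwa [one_div, inv_mul_le_iff₀ hpos', mul_comm] at h1

/-! ### Grid points outside a large set -/

/-- A finite absolutely continuous measure of a set is small when the set is. -/
theorem MeasureTheory.Measure.AbsolutelyContinuous.exists_pos_forall_lt {α : Type*}
    [MeasurableSpace α] {μ ν : Measure α} [SigmaFinite μ] [IsFiniteMeasure ν] (h : ν ≪ μ)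
    {ε : ENNReal} (hε : ε ≠ 0) : ∃ δ > 0, ∀ s, μ s < δ → ν s < ε := by
  obtain ⟨δ, hδ, H⟩ := exists_pos_setLIntegral_lt_of_measure_lt
    (Measure.lintegral_rnDeriv_lt_top ν μ).ne hε
  refine ⟨δ, hδ, fun s hs => ?_⟩
  rw [← Measure.withDensity_rnDeriv_eq ν μ h, withDensity_apply' _ s]
  exact H s hs

/-- If the open set `U` has measure more than `1 - δ` for the limit distribution, then eventually
at most a fraction `δ` of the grid points lies outside `U`. -/
theorem GridDistributed.eventually_card_notMem_le {p q : ℕ} {Ns Nr : ℕ → ℕ}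
    {x : ∀ n, Fin (Ns n) → Fin p → ℝ} {r : ∀ n, Fin (Nr n) → Fin q → ℝ}
    {ν : Measure (Fin p ⊕ Fin q → ℝ)} [IsProbabilityMeasure ν] (h : GridDistributed x r ν)
    {U : Set (Fin p ⊕ Fin q → ℝ)} (hU : IsOpen U) {δ : ℝ} (hUδ : 1 - δ < ν.real U) :
    ∀ᶠ n in atTop,
      ({a : Fin (Nr n) × Fin (Ns n) | Sum.elim (x n a.2) (r n a.1) ∉ U}.ncard : ℝ) ≤
        δ * (Ns n * Nr n) := by
  classical
  obtain ⟨K, hKU, hK, hKδ⟩ : ∃ K ⊆ U, IsClosed K ∧ 1 - δ < ν.real K := by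
    -- `ENNReal.ofReal` truncates negative numbers, so `δ > 1` is treated separately.
    rcases lt_or_ge (1 - δ) 0 with hneg | hnn
    · exact ⟨∅, Set.empty_subset _, isClosed_empty, by simpa using hneg⟩
    · obtain ⟨K, hKU, hK, hlt⟩ := hU.exists_lt_isClosed (μ := ν) (r := ENNReal.ofReal (1 - δ))
        ((ENNReal.ofReal_lt_iff_lt_toReal hnn (measure_ne_top _ _)).2 hUδ)
      exact ⟨K, hKU, hK, (ENNReal.ofReal_lt_iff_lt_toReal hnn (measure_ne_top _ _)).1 hlt⟩
  -- The Urysohn function `g` lies between the indicators of `K` and `U`: its grid mean bounds the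
  -- fraction of points in `U` from below.
  obtain ⟨g, hg0, hg1, hg01⟩ := exists_bounded_zero_one_of_closed hU.isClosed_compl hK
    (Set.disjoint_left.2 fun z hz hzK => hz (hKU hzK))
  have hint : ν.real K ≤ ∫ z, g z ∂ν := by
    rw [← integral_indicator_one hK.measurableSet]
    refine integral_mono ((integrable_const (1 : ℝ)).indicator hK.measurableSet)
      (g.integrable ν) fun z => ?_
    by_cases hz : z ∈ K
    · simp [hz, hg1 hz]
    · simpa [hz] using (hg01 z).1
  filter_upwards [(h g).eventually_const_lt (hKδ.trans_le hint)] with n hn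
  rw [Set.ncard_eq_toFinset_card', Set.toFinset_ofPred]
  have hsum : ∑ i, ∑ k, g (Sum.elim (x n i) (r n k)) +
      ((Finset.univ.filter fun a : Fin (Nr n) × Fin (Ns n) =>
        Sum.elim (x n a.2) (r n a.1) ∉ U).card : ℝ) ≤ Ns n * Nr n := by
    rw [Finset.card_filter, Nat.cast_sum, Finset.sum_comm, ← Fintype.sum_prod_type',
      ← Finset.sum_add_distrib]
    calc _ ≤ ∑ _a : Fin (Nr n) × Fin (Ns n), (1 : ℝ) := by
          refine Finset.sum_le_sum fun a _ => ?_
          by_cases ha : Sum.elim (x n a.2) (r n a.1) ∈ U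
          · simpa [ha] using (hg01 _).2
          · simp [ha, hg0 (x := Sum.elim (x n a.2) (r n a.1)) ha]
      _ = _ := by simp [mul_comm]
  rcases (Nat.zero_le (Ns n * Nr n)).eq_or_lt with h0 | hpos
  · have hN : (Ns n : ℝ) * Nr n = 0 := by exact_mod_cast h0.symm
    have hg_nonneg : 0 ≤ ∑ i, ∑ k, g (Sum.elim (x n i) (r n k)) :=
      Finset.sum_nonneg fun i _ => Finset.sum_nonneg fun k _ => (hg01 _).1
    rw [hN] at hsum ⊢
    linarith
  · have hN : (0 : ℝ) < (Ns n : ℝ) * Nr n := by exact_mod_cast hpos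
    rw [one_div, lt_inv_mul_iff₀ hN] at hn
    linarith

/-- A distributed family of grids is eventually nonempty. -/
theorem GridDistributed.eventually_pos {p q : ℕ} {Ns Nr : ℕ → ℕ}
    {x : ∀ n, Fin (Ns n) → Fin p → ℝ} {r : ∀ n, Fin (Nr n) → Fin q → ℝ}
    {ν : Measure (Fin p ⊕ Fin q → ℝ)} [IsProbabilityMeasure ν] (h : GridDistributed x r ν) :
    ∀ᶠ n in atTop, 0 < Ns n * Nr n := by
  have h1 := h (BoundedContinuousFunction.const _ 1)
  simp only [BoundedContinuousFunction.const_apply, integral_const, probReal_univ, smul_eq_mul,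
    mul_one] at h1
  -- On an empty grid the mean of the constant 1 is 0, since `1 / 0 = 0`.
  filter_upwards [h1.eventually_ne one_ne_zero] with n hn
  refine Nat.pos_of_ne_zero fun h0 => hn ?_
  have hN : (Ns n : ℝ) * Nr n = 0 := by exact_mod_cast h0
  rw [hN]
  simp

/-- The limit distribution does not charge the complement of a closed set containing the grids. -/
theorem GridDistributed.measure_compl_eq_zero {p q : ℕ} {Ns Nr : ℕ → ℕ}
    {x : ∀ n, Fin (Ns n) → Fin p → ℝ} {r : ∀ n, Fin (Nr n) → Fin q → ℝ}
    {ν : Measure (Fin p ⊕ Fin q → ℝ)} [IsProbabilityMeasure ν] (h : GridDistributed x r ν)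
    {Z : Set (Fin p ⊕ Fin q → ℝ)} (hZ : IsClosed Z)
    (hmem : ∀ n i k, Sum.elim (x n i) (r n k) ∈ Z) : ν Zᶜ = 0 := by
  by_contra hne
  have hpos : 0 < ν.real Zᶜ := ENNReal.toReal_pos hne (measure_ne_top _ _)
  -- No grid point lies in the open set `Zᶜ`, so all of them would make up a fraction `δ < 1` of a
  -- nonempty grid.
  obtain ⟨n, hn, hN⟩ := ((h.eventually_card_notMem_le hZ.isOpen_compl
    (δ := 1 - ν.real Zᶜ / 2) (by linarith)).and h.eventually_pos).exists
  have hN' : (0 : ℝ) < (Ns n : ℝ) * Nr n := by exact_mod_cast hN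
  have huniv : {a : Fin (Nr n) × Fin (Ns n) | Sum.elim (x n a.2) (r n a.1) ∉ Zᶜ} = Set.univ :=
    Set.eq_univ_of_forall fun a => by simpa using hmem n a.2 a.1
  rw [huniv, Set.ncard_univ, Nat.card_prod, Nat.card_fin, Nat.card_fin, Nat.cast_mul] at hn
  nlinarith

/-- Grids in a Peano–Jordan set `E`, with an absolutely continuous limit distribution, eventually
have all but a fraction `δ` of their points in a Peano–Jordan set that almost fills `E`. -/
theorem GridDistributed.exists_pos_forall_eventually_card_notMem_le {p q : ℕ} {Ns Nr : ℕ → ℕ}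
    {x : ∀ n, Fin (Ns n) → Fin p → ℝ} {r : ∀ n, Fin (Nr n) → Fin q → ℝ}
    {ν : Measure (Fin p ⊕ Fin q → ℝ)} [IsProbabilityMeasure ν] (h : GridDistributed x r ν)
    (hν : ν ≪ volume) {E : Set (Fin p ⊕ Fin q → ℝ)} (hE : IsPeanoJordan E)
    (hmem : ∀ n i k, Sum.elim (x n i) (r n k) ∈ E) {δ : ℝ} (hδ : 0 < δ) :
    ∃ η : ℝ, 0 < η ∧ ∀ A : Set (Fin p ⊕ Fin q → ℝ), IsPeanoJordan A →
      volume (E \ A) ≤ ENNReal.ofReal η → ∀ᶠ n in atTop,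
        ({a : Fin (Nr n) × Fin (Ns n) | Sum.elim (x n a.2) (r n a.1) ∉ A}.ncard : ℝ) ≤
          δ * (Ns n * Nr n) := by
  obtain ⟨η', hη', H⟩ := hν.exists_pos_forall_lt (ε := ENNReal.ofReal δ) (by simpa using hδ)
  obtain ⟨η, hη, hηlt⟩ := ENNReal.lt_iff_exists_real_btwn.1 hη'
  refine ⟨η, by simpa using hηlt.1, fun A hA hEA => ?_⟩
  have hclos : ν (closure E)ᶜ = 0 :=
    h.measure_compl_eq_zero isClosed_closure fun n i k => subset_closure (hmem n i k)
  -- All pieces but `E \ A` are `ν`-null: the frontiers by absolute continuity, the exterior of `E`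
  -- because the grids avoid it.
  have hsub : (interior A)ᶜ ⊆ ((closure E)ᶜ ∪ frontier E ∪ frontier A) ∪ (E \ A) := by
    intro z hz
    by_cases hzE : z ∈ E
    · by_cases hzA : z ∈ A
      · exact Or.inl (Or.inr ⟨subset_closure hzA, hz⟩)
      · exact Or.inr ⟨hzE, hzA⟩
    · by_cases hzc : z ∈ closure E
      · exact Or.inl (Or.inl (Or.inr ⟨hzc, fun hzi => hzE (interior_subset hzi)⟩))
      · exact Or.inl (Or.inl (Or.inl hzc))
  have hνc : ν (interior A)ᶜ < ENNReal.ofReal δ := by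
    refine (measure_mono hsub).trans_lt ((measure_union_le _ _).trans_lt ?_)
    rw [measure_union_null (measure_union_null hclos (hν hE.2)) (hν hA.2), zero_add]
    exact H _ (hEA.trans_lt hηlt.2)
  have hreal : ν.real (interior A)ᶜ < δ :=
    (ENNReal.lt_ofReal_iff_toReal_lt (measure_ne_top _ _)).1 hνc
  rw [probReal_compl_eq_one_sub isOpen_interior.measurableSet] at hreal
  filter_upwards [h.eventually_card_notMem_le isOpen_interior (δ := δ) (by linarith)] with n hn
  have hle : {a : Fin (Nr n) × Fin (Ns n) | Sum.elim (x n a.2) (r n a.1) ∉ A} ⊆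
      {a | Sum.elim (x n a.2) (r n a.1) ∉ interior A} :=
    fun a ha hi => ha (interior_subset hi)
  exact le_trans (by exact_mod_cast Set.ncard_le_ncard hle (Set.toFinite _)) hn

/-! ### Frobenius norm and weights -/

theorem scatteringMatrix_apply {p q Ns Nr : ℕ} (γ : (Fin p → ℝ) → (Fin q → ℝ) → ℝ)
    (Φ : (Fin p → ℝ) → (Fin q → ℝ) → (Fin q → ℝ) → ℝ)
    (x : Fin Ns → Fin p → ℝ) (r : Fin Nr → Fin q → ℝ) (w : Fin Nr → ℝ)
    (k l : Fin Nr) (i j : Fin Ns) :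
    scatteringMatrix γ Φ x r w (k, i) (l, j) =
      if i = j then γ (x i) (r k) * Φ (x i) (r k) (r l) * (w l / Nr) else 0 := by
  rw [scatteringMatrix, gammaMatrix, psiMatrix, weightMatrix, ← Matrix.blockDiagonal_mul,
    ← Matrix.blockDiagonal_mul, Matrix.blockDiagonal_apply]
  simp only [Matrix.mul_smul, Matrix.smul_apply, Matrix.mul_diagonal, Matrix.diagonal_mul,
    Matrix.of_apply, smul_eq_mul]
  congr 1
  ring

/-- Squared Frobenius norm of the part of the scattering matrix in which `γ Φ` is bounded by `B`
and the weights by `M`. -/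
theorem sum_sq_scatteringMatrix_le {p q Ns Nr : ℕ} (γ : (Fin p → ℝ) → (Fin q → ℝ) → ℝ)
    (Φ : (Fin p → ℝ) → (Fin q → ℝ) → (Fin q → ℝ) → ℝ)
    (x : Fin Ns → Fin p → ℝ) (r : Fin Nr → Fin q → ℝ) (w : Fin Nr → ℝ)
    (S : Finset (Fin Nr × Fin Ns)) (T : Finset (Fin Nr)) {B M C : ℝ} (hpos : 0 < Nr)
    (hM : 0 ≤ M)
    (hB : ∀ a ∈ S, ∀ l, |γ (x a.2) (r a.1) * Φ (x a.2) (r a.1) (r l)| ≤ B)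
    (hT : ∀ l ∈ T, |w l| ≤ M) (hC : ∑ l, |w l| ≤ C * Nr) :
    ∑ a ∈ S, ∑ b ∈ T ×ˢ Finset.univ, scatteringMatrix γ Φ x r w a b ^ 2 ≤
      Ns * (B ^ 2 * M * C) := by
  have hN : (0 : ℝ) < Nr := by exact_mod_cast hpos
  have hrow : ∀ a ∈ S, ∑ b ∈ T ×ˢ Finset.univ, scatteringMatrix γ Φ x r w a b ^ 2 ≤
      B ^ 2 * M * C / Nr := by
    rintro ⟨k, i⟩ ha
    rw [Finset.sum_product]
    simp only [scatteringMatrix_apply, ite_pow, zero_pow two_ne_zero, Finset.sum_ite_eq,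
      Finset.mem_univ, if_true]
    calc ∑ l ∈ T, (γ (x i) (r k) * Φ (x i) (r k) (r l) * (w l / Nr)) ^ 2
        -- Only one factor of `|w l| ^ 2` is replaced by `M`; the other is summed with the mean
        -- bound.
        ≤ ∑ l ∈ T, B ^ 2 * (M * |w l| / Nr ^ 2) := by
          refine Finset.sum_le_sum fun l hl => ?_
          rw [mul_pow, div_pow, ← sq_abs (_ * _), ← sq_abs (w l)]
          have h1 := hB _ ha l
          have h2 := hT l hl
          rw [sq |w l|]
          gcongr
      _ ≤ ∑ l, B ^ 2 * (M * |w l| / Nr ^ 2) :=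
          Finset.sum_le_sum_of_subset_of_nonneg (Finset.subset_univ T)
            fun l _ _ => by positivity
      _ = B ^ 2 * M / Nr ^ 2 * ∑ l, |w l| := by
          rw [Finset.mul_sum]
          exact Finset.sum_congr rfl fun l _ => by ring
      _ ≤ B ^ 2 * M / Nr ^ 2 * (C * Nr) := by gcongr
      _ = B ^ 2 * M * C / Nr := by field_simp
  have hC0 : 0 ≤ C :=
    nonneg_of_mul_nonneg_left ((Finset.sum_nonneg fun l _ => abs_nonneg (w l)).trans hC) hN
  calc _ ≤ ∑ _a ∈ S, B ^ 2 * M * C / Nr := Finset.sum_le_sum hrow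
    _ ≤ ∑ _a : Fin Nr × Fin Ns, B ^ 2 * M * C / Nr :=
        Finset.sum_le_sum_of_subset_of_nonneg (Finset.subset_univ S) fun _ _ _ => by positivity
    _ = Ns * (B ^ 2 * M * C) := by
        simp only [Finset.sum_const, Finset.card_univ, Fintype.card_prod, Fintype.card_fin,
          nsmul_eq_mul, Nat.cast_mul]
        field_simp

/-- Markov's inequality for weights. -/
theorem card_filter_lt_abs_le {ι : Type*} [Fintype ι] (w : ι → ℝ) {M c : ℝ} (hM : 0 < M)
    (hw : ∑ l, |w l| ≤ M * c) :
    ((Finset.univ.filter fun l => ¬ |w l| ≤ M).card : ℝ) ≤ c := by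
  have h : (Finset.univ.filter fun l => ¬ |w l| ≤ M).card * M ≤ ∑ l, |w l| := by
    rw [← nsmul_eq_mul]
    refine (Finset.card_nsmul_le_sum _ (fun l => |w l|) M fun l hl => ?_).trans
      (Finset.sum_le_sum_of_subset_of_nonneg (Finset.subset_univ _) fun _ _ _ => abs_nonneg _)
    exact (not_le.1 (Finset.mem_filter.1 hl).2).le
  refine le_of_mul_le_mul_right ?_ hM
  linarith

/-! ### From clustering to distribution -/

/-- A sequence of matrices of eventually positive size that is weakly clustered at zero is
distributed as the zero symbol. -/
theorem WeaklyClusteredSV.distributedSV_zero {κ : ℕ → Type} [∀ n, Fintype (κ n)]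
    [∀ n, DecidableEq (κ n)] {A : ∀ n, Matrix (κ n) (κ n) ℝ} (h : WeaklyClusteredSV A 0)
    (hpos : ∀ᶠ n in atTop, 0 < Fintype.card (κ n)) {ι : Type} [Fintype ι] {K : Set (ι → ℝ)}
    (hK0 : 0 < volume K) (hK : volume K < ⊤) : DistributedSV A (fun _ => 0) K := by
  intro F hF ⟨T, hT⟩
  have hlim : (1 / ((volume K).toReal : ℂ)) * ∫ _z in K, F ‖(0 : ℂ)‖ = F 0 := by
    have hne : ((volume K).toReal : ℂ) ≠ 0 := by
      exact_mod_cast (ENNReal.toReal_pos hK0.ne' hK.ne).ne'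
    rw [setIntegral_const, norm_zero, Measure.real, Complex.real_smul]
    field_simp
  rw [hlim]
  obtain ⟨B, hB⟩ : ∃ B, ∀ t, 0 ≤ t → ‖F t‖ ≤ B := by
    obtain ⟨B, hB⟩ := (isCompact_Icc (a := (0 : ℝ)) (b := T)).exists_bound_of_continuousOn
      (hF.mono fun t ht => ht.1)
    refine ⟨max B 0, fun t ht => ?_⟩
    rcases le_total t T with htT | htT
    · exact (hB t ⟨ht, htT⟩).trans (le_max_left _ _)
    · rw [hT t htT, norm_zero]
      exact le_max_right _ _
  have hB0 : 0 ≤ B := (norm_nonneg _).trans (hB 0 le_rfl)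
  rw [Metric.tendsto_nhds]
  intro η hη
  obtain ⟨ε, hε, hFε⟩ := Metric.continuousWithinAt_iff.1 (hF 0 Set.self_mem_Ici) (η / 3)
    (by positivity)
  -- `2 * B + 1` avoids division by zero when `B = 0`; the outliers then contribute at most `η / 3`
  -- to the mean.
  have hc : 0 < η / (3 * (2 * B + 1)) := by positivity
  filter_upwards [(h ε hε).bound hc, hpos] with n hn hN
  set N := Fintype.card (κ n)
  have hN' : (0 : ℝ) < N := by exact_mod_cast hN
  have hNC : (N : ℂ) ≠ 0 := by exact_mod_cast hN.ne'
  simp only [Real.norm_natCast] at hn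
  set σ := matrixSingularValue (A n)
  have hσ : ∀ i, 0 ≤ σ i := fun i => LinearMap.singularValues_nonneg _ i
  have hterm : ∀ i, ‖F (σ i) - F 0‖ ≤ η / 3 + 2 * B * if ε ≤ |σ i - 0| then 1 else 0 := by
    intro i
    split_ifs with hi
    · have := norm_sub_le (F (σ i)) (F 0)
      have := hB _ (hσ i)
      have := hB 0 le_rfl
      linarith
    · have := hFε (x := σ i) (hσ i) (by rw [Real.dist_eq]; exact not_le.1 hi)
      rw [dist_eq_norm] at this
      linarith
  have hcount : ∑ i ∈ Finset.range N, (if ε ≤ |σ i - 0| then (1 : ℝ) else 0) =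
      numSingularValuesOff (A n) 0 ε := by
    rw [numSingularValuesOff, Finset.card_filter]
    push_cast
    rfl
  have hdiff : 1 / (N : ℂ) * ∑ i ∈ Finset.range N, F (σ i) - F 0 =
      1 / (N : ℂ) * ∑ i ∈ Finset.range N, (F (σ i) - F 0) := by
    rw [Finset.sum_sub_distrib, Finset.sum_const, Finset.card_range, nsmul_eq_mul]
    field_simp
  rw [dist_eq_norm, hdiff, norm_mul, norm_div, norm_one, Complex.norm_natCast, one_div,
    inv_mul_lt_iff₀ hN']
  calc ‖∑ i ∈ Finset.range N, (F (σ i) - F 0)‖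
      ≤ ∑ i ∈ Finset.range N, (η / 3 + 2 * B * if ε ≤ |σ i - 0| then 1 else 0) :=
        norm_sum_le_of_le _ fun i _ => hterm i
    _ = N * (η / 3) + 2 * B * numSingularValuesOff (A n) 0 ε := by
        rw [Finset.sum_add_distrib, ← Finset.mul_sum, hcount, Finset.sum_const,
          Finset.card_range, nsmul_eq_mul]
    _ ≤ N * (η / 3) + (2 * B + 1) * (η / (3 * (2 * B + 1)) * N) := by
        gcongr
        linarith
    _ = N * (2 * η / 3) := by
        field_simp
        ring
    _ < N * η := by
        gcongr
        linarith

/-! ### The main theorem -/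

theorem mainTheorem4 {p q : ℕ}
    (D : Set (Fin p → ℝ)) (R : Set (Fin q → ℝ)) (hDR : IsPeanoJordan (prodSet D R))
    (γ : (Fin p → ℝ) → (Fin q → ℝ) → ℝ)
    (hγ : GenRiemannIntegrableOn (onProd γ) (prodSet D R))
    (Φ : (Fin p → ℝ) → (Fin q → ℝ) → (Fin q → ℝ) → ℝ)
    (hΦ : ∀ y ∈ D, RiemannIntegrableOn (onProd (Φ y)) (prodSet R R))
    (hΦ_bdd : ∀ A : Set (Fin p → ℝ), A ⊆ D → IsCompact A →
      ∃ C : ℝ, ∀ y ∈ A, ∀ s ∈ R, ∀ t ∈ R, |Φ y s t| ≤ C)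
    (Ns Nr : ℕ → ℕ) (hNr : Tendsto Nr atTop atTop)
    (x : ∀ n, Fin (Ns n) → Fin p → ℝ) (hx : ∀ n i, x n i ∈ D)
    (r : ∀ n, Fin (Nr n) → Fin q → ℝ) (hr : ∀ n k, r n k ∈ R)
    (hr_inj : ∀ n, Function.Injective (r n))
    (ν : Measure (Fin p ⊕ Fin q → ℝ)) [IsProbabilityMeasure ν] (hν : ν ≪ volume)
    (hgrid : GridDistributed x r ν)
    (w : ∀ n, Fin (Nr n) → ℝ) (hw : QuadratureConverges r w R) :
    WeaklyClusteredSV (fun n => scatteringMatrix γ Φ (x n) (r n) (w n)) 0 ∧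
    ∀ (ι : Type) [Fintype ι] (K : Set (ι → ℝ)), NullMeasurableSet K volume →
      0 < volume K → volume K < ⊤ →
      DistributedSV (fun n => scatteringMatrix γ Φ (x n) (r n) (w n)) (fun _ => 0) K := by
  classical
  have hcluster : WeaklyClusteredSV (fun n => scatteringMatrix γ Φ (x n) (r n) (w n)) 0 := by
    intro ε hε
    refine IsLittleO.of_bound fun c hc => ?_
    obtain ⟨C, hC0, hC⟩ := hw.exists_sum_abs_le hr_inj
    obtain ⟨η, hη, hgridA⟩ := hgrid.exists_pos_forall_eventually_card_notMem_le hν hDR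
      (fun n i k => ⟨hx n i, hr n k⟩) (δ := c / 3) (by positivity)
    obtain ⟨A, hAsub, hAc, hAPJ, hAvol, ⟨G, hG⟩, -⟩ := hγ η hη
    -- The spatial projection of `A` is compact in `D`, so the local bound on `Φ` applies to every
    -- row kept.
    obtain ⟨P, hP⟩ := hΦ_bdd ((fun z => z ∘ Sum.inl) '' A)
      (by rintro _ ⟨z, hz, rfl⟩; exact (hAsub hz).1) (hAc.image (by fun_prop))
    -- Chosen so that Markov's inequality discards at most a fraction `c / 3` of the columns; rows
    -- and the Frobenius term get the other two thirds of `c`.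
    set M := 3 * C / c with hM
    have hM0 : 0 < M := by positivity
    filter_upwards [hgridA A hAPJ hAvol, (tendsto_natCast_atTop_atTop.comp hNr).eventually_ge_atTop
      ((G * P) ^ 2 * M * C / ε ^ 2 / (c / 3)), hNr.eventually_gt_atTop 0] with n hS hlarge hpos
    have hN : (0 : ℝ) < Nr n := by exact_mod_cast hpos
    let S : Finset (Fin (Nr n) × Fin (Ns n)) :=
      Finset.univ.filter fun a => Sum.elim (x n a.2) (r n a.1) ∈ A
    let T : Finset (Fin (Nr n)) := Finset.univ.filter fun l => |w n l| ≤ M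
    have hScard : (Sᶜ.card : ℝ) ≤ c / 3 * (Ns n * Nr n) := by
      rw [Set.ncard_eq_toFinset_card', Set.toFinset_ofPred] at hS
      rwa [Finset.compl_filter]
    have hTcard : (((T ×ˢ (Finset.univ : Finset (Fin (Ns n))))ᶜ).card : ℝ) ≤
        c / 3 * (Ns n * Nr n) := by
      have h1 : ((T ×ˢ (Finset.univ : Finset (Fin (Ns n))))ᶜ) = Tᶜ ×ˢ Finset.univ := by
        ext a
        simp
      have h2 : (Tᶜ.card : ℝ) ≤ c / 3 * Nr n := by
        rw [Finset.compl_filter]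
        refine card_filter_lt_abs_le (w n) hM0 ((hC n).trans_eq ?_)
        rw [hM]
        field_simp
      rw [h1, Finset.card_product, Finset.card_univ, Fintype.card_fin, Nat.cast_mul]
      calc (Tᶜ.card : ℝ) * Ns n ≤ c / 3 * Nr n * Ns n := by gcongr
        _ = _ := by ring
    have hfrob := sum_sq_scatteringMatrix_le γ Φ (x n) (r n) (w n) S T (B := G * P) (C := C) hpos
      hM0.le (fun a ha l => by
        have haA : Sum.elim (x n a.2) (r n a.1) ∈ A := (Finset.mem_filter.1 ha).2
        have h1 : |γ (x n a.2) (r n a.1)| ≤ G := hG _ haA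
        have h2 : |Φ (x n a.2) (r n a.1) (r n l)| ≤ P :=
          hP _ ⟨_, haA, rfl⟩ _ (hr n a.1) _ (hr n l)
        rw [abs_mul]
        exact mul_le_mul h1 h2 (abs_nonneg _) ((abs_nonneg _).trans h1))
      (fun l hl => (Finset.mem_filter.1 hl).2) (hC n)
    have hcount := numSingularValuesOff_zero_le (scatteringMatrix γ Φ (x n) (r n) (w n)) S
      (T ×ˢ Finset.univ) hε
    have hlast : (Ns n : ℝ) * ((G * P) ^ 2 * M * C) / ε ^ 2 ≤ c / 3 * (Ns n * Nr n) := by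
      rw [div_le_iff₀ (by positivity)] at hlarge
      calc (Ns n : ℝ) * ((G * P) ^ 2 * M * C) / ε ^ 2
          = Ns n * ((G * P) ^ 2 * M * C / ε ^ 2) := by ring
        _ ≤ Ns n * (Nr n * (c / 3)) := by gcongr; exact hlarge
        _ = _ := by ring
    have hfrob' := div_le_div_of_nonneg_right hfrob (sq_nonneg ε)
    rw [Real.norm_natCast, Real.norm_natCast, Fintype.card_prod, Fintype.card_fin,
      Fintype.card_fin, Nat.cast_mul]
    linarith
  refine ⟨hcluster, fun ι _ K _ hK0 hK => hcluster.distributedSV_zero ?_ hK0 hK⟩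
  filter_upwards [hgrid.eventually_pos] with n hn
  rwa [Fintype.card_prod, Fintype.card_fin, Fintype.card_fin, mul_comm]
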